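/- **Theorem 2.1.** Let $K$ be a field of characteristic $0$, $n\ge 2$, $q\in K\setminus\{0\}$, and let $K\langle Z\rangle$ be the free associative unital $K$-algebra on $Z=\{Z_{ij}\mid 1\le i,j\le n\}$. Let $S\subset K\langle Z\rangle$ be the set of defining relations of the Faddeev–Reshetikhin–Takhtajan quantized matrix algebra $M_q(n)\cong K\langle Z\rangle/\langle S\rangle$, that is, the set of all elements - (a) $Z_{ij}Z_{ik}-qZ_{ik}Z_{ij}$ with $j<k$; - (b) $Z_{ij}Z_{kj}-qZ_{kj}Z_{ij}$ with $i<k$; - (c) $Z_{ij}Z_{st}-Z_{st}Z_{ij}$ with $i<s$, $t<j$; - (d) $Z_{ij}Z_{st}-Z_{st}Z_{ij}-(q-q^{-1})Z_{it}Z_{sj}$ with $i<s$, $j<t$; and let $J=\langle S\rangle$ be the two-sided ideal of $K\langle Z\rangle$ generated by $S$. Order the generators by $Z_{kl}<Z_{ij}$ iff $k<i$, or $k=i$ and $l<j$. Let $\prec$ be the degree-preserving right lexicographic ordering on the set $Z^*$ of words: $u\prec v$ iff $|u|<|v|$, or $|u|=|v|$ and $u$ has the smaller letter at the rightmost position at which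 $u$ and $v$ differ. For $0\ne f\in K\langle Z\rangle$ let $\overline f$ denote the $\prec$-largest word occurring in $f$; $f$ is monic if $\overline f$ has coefficient $1$. For monic $f,g$, a composition of $f$ and $g$ at the word $w$ is one of the following elements, where $a,b\in Z^*$: - (intersection) $(f,g)_w=fb-ag$, if $w=\overline f\,b=a\,\overline g$ with $a,b\ne1$ and $|w|<|\overline f|+|\overline g|$; - (inclusion) $(f,g)_w=f-agb$, if $w=\overline f=a\,\overline g\,b$. An element $h$ is trivial modulo $(S,w)$ if $h=\sum_m\alpha_m a_m s_m b_m$ is a finite sum with $\alpha_m\in K$, $a_m,b_m\in Z^*$, $s_m\in S$ and $a_m\overline{s_m}b_m\prec w$ for all $m$. Then $\prec$ is a monomial ordering on $Z^*$ (a well-ordering such that $u\prec v$ implies $wur\prec wvr$ for all words $w,r$), and $S$ is a Gröbner–Shirshov basis of $J$ with respect to $\prec$: all elements of $S$ are monic, and every composition $(f,g)_w$ with $f,g\in S$ is trivial modulo $(S,w)$. Also, for every nonzero $f\in J$ the word $\overline f$ contains $\overline s$ as a factor for some $s\in S$. The words $w$ at which elements of $S$ have compositions of intersection are exactly those in the following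 $16$ families (all indices in $\{1,\dots,n\}$; $x\wedge y$ indicates the types of the two relations involved): - $a\wedge a$: $Z_{ij}Z_{ik}Z_{is}$, $j<k<s$; - $a\wedge b$: $Z_{ij}Z_{ik}Z_{sk}$, $j<k$, $i<s$; and $Z_{ij}Z_{kj}Z_{ks}$, $i<k$, $j<s$; - $b\wedge b$: $Z_{ij}Z_{kj}Z_{sj}$, $i<k<s$; - $a\wedge c$: $Z_{ij}Z_{st}Z_{sk}$, $i<s$, $t<j$, $t<k$; and $Z_{ij}Z_{ik}Z_{st}$, $j<k$, $i<s$, $t<k$; - $c\wedge c$: $Z_{ij}Z_{st}Z_{kl}$, $i<s<k$, $l<t<j$; - $b\wedge c$: $Z_{ij}Z_{kj}Z_{st}$, $i<k<s$, $t<j$; and $Z_{ij}Z_{st}Z_{kt}$, $i<s<k$, $t<j$; - $a\wedge d$: $Z_{ij}Z_{st}Z_{sk}$, $i<s$, $j<t<k$; and $Z_{ij}Z_{ik}Z_{st}$, $i<s$, $j<k<t$; - $b\wedge d$: $Z_{ij}Z_{kj}Z_{st}$, $i<k<s$, $j<t$; and $Z_{st}Z_{ij}Z_{kj}$, $s<i<k$,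 $t<j$; - $c\wedge d$: $Z_{ij}Z_{st}Z_{kl}$, $i<s<k$, $t<j$, $t<l$; and $Z_{kl}Z_{ij}Z_{st}$, $k<i<s$, $t<j$, $l<j$; - $d\wedge d$: $Z_{ij}Z_{st}Z_{kl}$, $i<s<k$, $j<t<l$. In particular, all compositions at these words are trivial modulo $(S,w)$. -/

import Mathlib

namespace GroebnerShirshov

variable {K X : Type*} [Field K]

/-- The monomial (word) `x₁x₂⋯xₘ`, seen as an element of the free algebra `K⟨X⟩`. -/
def word (K : Type*) {X : Type*} [Field K] (w : FreeMonoid X) : FreeAlgebra K X :=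
  FreeMonoid.lift (FreeAlgebra.ι K) w

/-- The coefficient of the word `w` in the noncommutative polynomial `f`. -/
noncomputable def coeff (f : FreeAlgebra K X) (w : FreeMonoid X) : K :=
  (FreeAlgebra.equivMonoidAlgebraFreeMonoid f : MonoidAlgebra K (FreeMonoid X)).coeff w

/-- A monomial ordering on `X^*`: a well-ordering (strict and total) that is compatible with
multiplication of words on both sides. -/
def IsMonomialOrder (lt : FreeMonoid X → FreeMonoid X → Prop) : Prop :=
  IsWellOrder (FreeMonoid X) lt ∧ ∀ u v w r, lt u v → lt (w * u * r) (w * v * r)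

/-- `w` is the leading word of `f`: it occurs in `f`, and each other word that occurs in `f` is
smaller. (The zero polynomial has no leading word.) -/
def IsLeadingWord (lt : FreeMonoid X → FreeMonoid X → Prop) (f : FreeAlgebra K X)
    (w : FreeMonoid X) : Prop :=
  coeff f w ≠ 0 ∧ ∀ u, coeff f u ≠ 0 → u ≠ w → lt u w

/-- `f` is nonzero with leading coefficient `1`. -/
def IsMonic (lt : FreeMonoid X → FreeMonoid X → Prop) (f : FreeAlgebra K X) : Prop :=
  ∃ w, IsLeadingWord lt f w ∧ coeff f w = 1

/-- `h` is trivial modulo `(S, w)`: `h = ∑ αᵢ aᵢ sᵢ bᵢ` (a finite sum) with `αᵢ ∈ K`, `sᵢ ∈ S`,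
words `aᵢ, bᵢ`, and `aᵢ s̄ᵢ bᵢ ≺ w` for all `i`, where `s̄ᵢ` is the leading word of `sᵢ`. -/
def IsTrivialMod (lt : FreeMonoid X → FreeMonoid X → Prop) (S : Set (FreeAlgebra K X))
    (w : FreeMonoid X) (h : FreeAlgebra K X) : Prop :=
  h ∈ Submodule.span K {p : FreeAlgebra K X | ∃ s ∈ S, ∃ u a b : FreeMonoid X,
    IsLeadingWord lt s u ∧ lt (a * u * b) w ∧ p = word K a * s * word K b}

/-- `w = f̄ b = a ḡ`, where `a, b ≠ 1` and the factors `f̄` and `ḡ` of `w` overlap. (If `a = 1` or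
`b = 1`, one of `f̄, ḡ` is a factor of the other: see `IsInclusion`.) -/
def IsIntersection (lt : FreeMonoid X → FreeMonoid X → Prop) (f g : FreeAlgebra K X)
    (a b w : FreeMonoid X) : Prop :=
  ∃ u v, IsLeadingWord lt f u ∧ IsLeadingWord lt g v ∧ w = u * b ∧ w = a * v ∧
    a ≠ 1 ∧ b ≠ 1 ∧ w.length < u.length + v.length

/-- `w = f̄ = a ḡ b`. -/
def IsInclusion (lt : FreeMonoid X → FreeMonoid X → Prop) (f g : FreeAlgebra K X)
    (a b w : FreeMonoid X) : Prop :=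
  ∃ v, IsLeadingWord lt f w ∧ IsLeadingWord lt g v ∧ w = a * v * b

/-- `h` is a composition `(f, g)_w`, of intersection or of inclusion. -/
inductive IsComposition (lt : FreeMonoid X → FreeMonoid X → Prop) (f g : FreeAlgebra K X)
    (w : FreeMonoid X) : FreeAlgebra K X → Prop
  | intersection (a b : FreeMonoid X) (h : IsIntersection lt f g a b w) :
      IsComposition lt f g w (f * word K b - word K a * g)
  | inclusion (a b : FreeMonoid X) (h : IsInclusion lt f g a b w) :
      IsComposition lt f g w (f - word K a * g * word K b)

/-- `S` is a Gröbner–Shirshov basis of the two-sided ideal `J` with respect to `lt`: `S` consists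
of monic polynomials, it generates `J`, and all compositions of elements of `S` are trivial. -/
structure IsGroebnerShirshovBasis (lt : FreeMonoid X → FreeMonoid X → Prop)
    (S : Set (FreeAlgebra K X)) (J : TwoSidedIdeal (FreeAlgebra K X)) : Prop where
  monic : ∀ s ∈ S, IsMonic lt s
  span_eq : TwoSidedIdeal.span S = J
  trivial : ∀ f ∈ S, ∀ g ∈ S, ∀ w h, IsComposition lt f g w h → IsTrivialMod lt S w h

end GroebnerShirshov

namespace QuantumMatrix

/-- The order on the index set of the generators: `Z_kl < Z_ij` iff `k < i`, or `k = i` and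
`l < j`. -/
def letterLt {n : ℕ} (x y : Fin n × Fin n) : Prop :=
  x.1 < y.1 ∨ (x.1 = y.1 ∧ x.2 < y.2)

/-- The degree-preserving right lexicographic ordering: first compare the lengths, then compare
words of the same length lexicographically, reading from right to left. -/
def degRlex {n : ℕ} (u v : FreeMonoid (Fin n × Fin n)) : Prop :=
  u.length < v.length ∨
    (u.length = v.length ∧ List.Lex letterLt u.toList.reverse v.toList.reverse)

/-- The generator `Z_ij` of the free algebra. -/
def Z (K : Type*) [Field K] {n : ℕ} (i j : Fin n) : FreeAlgebra K (Fin n × Fin n) :=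
  FreeAlgebra.ι K (i, j)

/-- The set `S` of defining relations of `M_q(n)`. -/
inductive Rel (K : Type*) [Field K] (n : ℕ) (q : K) : FreeAlgebra K (Fin n × Fin n) → Prop
  | a (i j k : Fin n) (h : j < k) : Rel K n q (Z K i j * Z K i k - q • (Z K i k * Z K i j))
  | b (i j k : Fin n) (h : i < k) : Rel K n q (Z K i j * Z K k j - q • (Z K k j * Z K i j))
  | c (i j s t : Fin n) (h₁ : i < s) (h₂ : t < j) :
      Rel K n q (Z K i j * Z K s t - Z K s t * Z K i j)
  | d (i j s t : Fin n) (h₁ : i < s) (h₂ : j < t) :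
      Rel K n q (Z K i j * Z K s t - Z K s t * Z K i j - (q - q⁻¹) • (Z K i t * Z K s j))

/-- The set `S` of defining relations of `M_q(n)`, as a set. -/
def relations (K : Type*) [Field K] (n : ℕ) (q : K) : Set (FreeAlgebra K (Fin n × Fin n)) :=
  {f | Rel K n q f}

/-- The word `Z_ij Z_kl Z_st`. -/
def word3 {n : ℕ} (i j k l s t : Fin n) : FreeMonoid (Fin n × Fin n) :=
  FreeMonoid.of (i, j) * FreeMonoid.of (k, l) * FreeMonoid.of (s, t)

/-- The sixteen families of words at which leading words of defining relations overlap. The name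
`xy₁`, `xy₂` refers to the types `x`, `y` of the two relations involved. -/
inductive Ambiguity {n : ℕ} : FreeMonoid (Fin n × Fin n) → Prop
  | aa (i j k s : Fin n) : j < k → k < s → Ambiguity (word3 i j i k i s)
  | ab₁ (i j k s : Fin n) : j < k → i < s → Ambiguity (word3 i j i k s k)
  | ab₂ (i j k s : Fin n) : i < k → j < s → Ambiguity (word3 i j k j k s)
  | bb (i j k s : Fin n) : i < k → k < s → Ambiguity (word3 i j k j s j)
  | ac₁ (i j s t k : Fin n) : i < s → t < j → t < k → Ambiguity (word3 i j s t s k)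
  | ac₂ (i j k s t : Fin n) : j < k → i < s → t < k → Ambiguity (word3 i j i k s t)
  | cc (i j s t k l : Fin n) : i < s → s < k → l < t → t < j → Ambiguity (word3 i j s t k l)
  | bc₁ (i j k s t : Fin n) : i < k → k < s → t < j → Ambiguity (word3 i j k j s t)
  | bc₂ (i j s t k : Fin n) : i < s → s < k → t < j → Ambiguity (word3 i j s t k t)
  | ad₁ (i j s t k : Fin n) : i < s → j < t → t < k → Ambiguity (word3 i j s t s k)
  | ad₂ (i j k s t : Fin n) : i < s → j < k → k < t → Ambiguity (word3 i j i k s t)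
  | bd₁ (i j k s t : Fin n) : i < k → k < s → j < t → Ambiguity (word3 i j k j s t)
  | bd₂ (s t i j k : Fin n) : s < i → i < k → t < j → Ambiguity (word3 s t i j k j)
  | cd₁ (i j s t k l : Fin n) : i < s → s < k → t < j → t < l → Ambiguity (word3 i j s t k l)
  | cd₂ (k l i j s t : Fin n) : k < i → i < s → t < j → l < j → Ambiguity (word3 k l i j s t)
  | dd (i j s t k l : Fin n) : i < s → s < k → j < t → t < l → Ambiguity (word3 i j s t k l)

end QuantumMatrix

/-! There are two halves. The first holds in any free algebra with a monomial ordering and is the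
Composition-Diamond lemma. If two multiples `a s b` and `c t d` of elements of `S` have the same
leading word, their difference is trivial modulo that word (`isTrivialMod_sub_of_eq`): the two
occurrences are disjoint, nested or overlapping, and the last two cases are compositions. So the top
terms of a representation of `f` merge into one. Either it survives and its leading word is that of
`f`, or it cancels and the bound on the representation drops (`IsTrivialMod.eq_zero_or_exists`).

The second half treats the relations. The types (a)–(d) are the four relative positions of two
generators `x < y`, so each increasing pair `xy` is the leading word of exactly one relation.
Overlaps are therefore the increasing triples `x < y < z`, and the types of `xy` and `yz` give 4 · 4
= 16 families. Inclusions force `f = g` and give `0`. A composition at `xyz` is trivial because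
rewriting below `xyz` brings its terms to a combination of descending words in which everything
cancels (`overlap_eq_zero`). -/

namespace GroebnerShirshov

variable {K X : Type*} [Field K]

/-! ### Words and coefficients in the free algebra -/

@[simp] theorem word_one : word K (1 : FreeMonoid X) = 1 := map_one _

theorem word_mul (u v : FreeMonoid X) : word K (u * v) = word K u * word K v := map_mul _ _ _

@[simp] theorem coeff_zero (w : FreeMonoid X) : coeff (0 : FreeAlgebra K X) w = 0 := by
  simp [coeff]

@[simp] theorem coeff_add (f g : FreeAlgebra K X) (w : FreeMonoid X) :
    coeff (f + g) w = coeff f w + coeff g w := by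
  simp [coeff]

@[simp] theorem coeff_sub (f g : FreeAlgebra K X) (w : FreeMonoid X) :
    coeff (f - g) w = coeff f w - coeff g w := by
  simp [coeff]

@[simp] theorem coeff_smul (c : K) (f : FreeAlgebra K X) (w : FreeMonoid X) :
    coeff (c • f) w = c * coeff f w := by
  simp [coeff]

theorem equivMonoidAlgebraFreeMonoid_symm_single (u : FreeMonoid X) (c : K) :
    FreeAlgebra.equivMonoidAlgebraFreeMonoid.symm (MonoidAlgebra.single u c) = c • word K u :=
  MonoidAlgebra.lift_single ..

theorem equivMonoidAlgebraFreeMonoid_word (u : FreeMonoid X) :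
    FreeAlgebra.equivMonoidAlgebraFreeMonoid (word K u) = MonoidAlgebra.single u 1 := by
  rw [← AlgEquiv.eq_symm_apply, equivMonoidAlgebraFreeMonoid_symm_single, one_smul]

@[simp] theorem coeff_word_self (u : FreeMonoid X) : coeff (word K u) u = 1 := by
  simp [coeff, equivMonoidAlgebraFreeMonoid_word]

theorem coeff_word_of_ne {u w : FreeMonoid X} (h : u ≠ w) : coeff (word K u) w = 0 := by
  simp [coeff, equivMonoidAlgebraFreeMonoid_word, h]

theorem mem_span_word_of_coeff_ne_zero (f : FreeAlgebra K X) :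
    f ∈ Submodule.span K (word K '' {u | coeff f u ≠ 0}) := by
  have hf : ∑ u ∈ (FreeAlgebra.equivMonoidAlgebraFreeMonoid f).coeff.support,
      coeff f u • word K u = f := by
    apply FreeAlgebra.equivMonoidAlgebraFreeMonoid.injective
    simp only [map_sum, map_smul, equivMonoidAlgebraFreeMonoid_word, MonoidAlgebra.smul_single,
      smul_eq_mul, mul_one]
    exact MonoidAlgebra.sum_coeff_single _
  have h : ∑ u ∈ (FreeAlgebra.equivMonoidAlgebraFreeMonoid f).coeff.support,
      coeff f u • word K u ∈ Submodule.span K (word K '' {u | coeff f u ≠ 0}) :=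
    Submodule.sum_mem _ fun u hu => Submodule.smul_mem _ _
      (Submodule.subset_span ⟨u, by simpa [coeff] using hu, rfl⟩)
  rwa [hf] at h

theorem span_range_word : Submodule.span K (Set.range (word K (X := X))) = ⊤ :=
  eq_top_iff.2 fun f _ => Submodule.span_mono (Set.image_subset_range _ _)
    (mem_span_word_of_coeff_ne_zero f)

/-! ### Leading words and the span of smaller words -/

variable {lt : FreeMonoid X → FreeMonoid X → Prop} {S : Set (FreeAlgebra K X)}

/-- The combinations of words that are smaller than `w`. -/
def lower (K : Type*) [Field K] (lt : FreeMonoid X → FreeMonoid X → Prop) (w : FreeMonoid X) :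
    Submodule K (FreeAlgebra K X) :=
  Submodule.span K (word K '' {u | lt u w})

theorem word_mem_lower {u w : FreeMonoid X} (h : lt u w) : word K u ∈ lower K lt w :=
  Submodule.subset_span ⟨u, h, rfl⟩

theorem lt_of_mem_lower {f : FreeAlgebra K X} {u w : FreeMonoid X} (hf : f ∈ lower K lt w)
    (hu : coeff f u ≠ 0) : lt u w := by
  by_contra h
  refine hu ?_
  induction hf using Submodule.span_induction with
  | mem x hx =>
    obtain ⟨v, hv, rfl⟩ := hx
    exact coeff_word_of_ne fun e => h (e ▸ hv)
  | zero => simp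
  | add x y _ _ hx hy =>
    by_cases hx' : coeff x u = 0
    · by_cases hy' : coeff y u = 0
      · simp [hx', hy']
      · exact absurd (hy hy') hy'
    · exact absurd (hx hx') hx'
  | smul c x _ hx =>
    by_cases hx' : coeff x u = 0
    · simp [hx']
    · exact absurd (hx hx') hx'

theorem mul_mem_lower (hlt : IsMonomialOrder lt) {f : FreeAlgebra K X} {w : FreeMonoid X}
    (hf : f ∈ lower K lt w) (a b : FreeMonoid X) :
    word K a * f * word K b ∈ lower K lt (a * w * b) := by
  induction hf using Submodule.span_induction with
  | mem x hx =>
    obtain ⟨v, hv, rfl⟩ := hx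
    rw [← word_mul, ← word_mul]
    exact word_mem_lower (hlt.2 _ _ _ _ hv)
  | zero => simp
  | add x y _ _ hx hy =>
    rw [mul_add, add_mul]
    exact add_mem hx hy
  | smul c x _ hx =>
    rw [mul_smul_comm, smul_mul_assoc]
    exact Submodule.smul_mem _ _ hx

theorem lower_mono (hlt : IsMonomialOrder lt) {u w : FreeMonoid X} (h : lt u w) :
    lower K lt u ≤ lower K lt w := by
  have := hlt.1
  exact Submodule.span_mono (Set.image_mono fun v hv => _root_.trans hv h)

theorem IsLeadingWord.unique (hlt : IsMonomialOrder lt) {f : FreeAlgebra K X} {u v : FreeMonoid X}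
    (hu : IsLeadingWord lt f u) (hv : IsLeadingWord lt f v) : u = v := by
  have := hlt.1
  by_contra h
  exact asymm_of lt (hu.2 v hv.1 (Ne.symm h)) (hv.2 u hu.1 h)

/-- A polynomial whose leading term is `c u`, given by its difference with this term. -/
theorem isLeadingWord_of_sub_mem_lower (hlt : IsMonomialOrder lt) {f : FreeAlgebra K X}
    {u : FreeMonoid X} {c : K} (hc : c ≠ 0) (h : f - c • word K u ∈ lower K lt u) :
    IsLeadingWord lt f u ∧ coeff f u = c := by
  have := hlt.1
  have hcu : coeff f u = c := by
    by_contra hne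
    refine irrefl_of lt u (lt_of_mem_lower h ?_)
    simpa [sub_eq_zero] using hne
  refine ⟨⟨hcu ▸ hc, fun v hv hvu => lt_of_mem_lower h ?_⟩, hcu⟩
  simpa [coeff_word_of_ne hvu.symm] using hv

theorem IsLeadingWord.sub_mem_lower {f : FreeAlgebra K X} {u : FreeMonoid X}
    (h : IsLeadingWord lt f u) (h1 : coeff f u = 1) : f - word K u ∈ lower K lt u := by
  refine Submodule.span_mono (Set.image_mono fun v hv => ?_)
    (mem_span_word_of_coeff_ne_zero (f - word K u))
  have hvu : v ≠ u := by
    rintro rfl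
    simp [h1] at hv
  exact h.2 v (by simpa [coeff_word_of_ne hvu.symm] using hv) hvu

theorem IsMonic.sub_mem_lower (hlt : IsMonomialOrder lt) {f : FreeAlgebra K X} {u : FreeMonoid X}
    (hf : IsMonic lt f) (h : IsLeadingWord lt f u) : f - word K u ∈ lower K lt u := by
  obtain ⟨v, hv, hv1⟩ := hf
  obtain rfl := h.unique hlt hv
  exact h.sub_mem_lower hv1

/-! ### Calculus of triviality modulo `(S, w)` -/

theorem isTrivialMod_zero (w : FreeMonoid X) : IsTrivialMod lt S w 0 := Submodule.zero_mem _

theorem IsTrivialMod.add {w : FreeMonoid X} {f g : FreeAlgebra K X} (hf : IsTrivialMod lt S w f)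
    (hg : IsTrivialMod lt S w g) : IsTrivialMod lt S w (f + g) := Submodule.add_mem _ hf hg

theorem IsTrivialMod.sub {w : FreeMonoid X} {f g : FreeAlgebra K X} (hf : IsTrivialMod lt S w f)
    (hg : IsTrivialMod lt S w g) : IsTrivialMod lt S w (f - g) := Submodule.sub_mem _ hf hg

theorem IsTrivialMod.neg {w : FreeMonoid X} {f : FreeAlgebra K X} (hf : IsTrivialMod lt S w f) :
    IsTrivialMod lt S w (-f) := Submodule.neg_mem _ hf

theorem IsTrivialMod.smul {w : FreeMonoid X} {f : FreeAlgebra K X} (c : K)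
    (hf : IsTrivialMod lt S w f) : IsTrivialMod lt S w (c • f) := Submodule.smul_mem _ _ hf

theorem isTrivialMod_of_lt {s : FreeAlgebra K X} (hs : s ∈ S) {u a b w : FreeMonoid X}
    (hu : IsLeadingWord lt s u) (h : lt (a * u * b) w) :
    IsTrivialMod lt S w (word K a * s * word K b) :=
  Submodule.subset_span ⟨s, hs, u, a, b, hu, h, rfl⟩

theorem IsTrivialMod.mono (hlt : IsMonomialOrder lt) {w w' : FreeMonoid X} (hw : lt w w')
    {f : FreeAlgebra K X} (hf : IsTrivialMod lt S w f) : IsTrivialMod lt S w' f := by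
  have := hlt.1
  refine Submodule.span_mono ?_ hf
  rintro _ ⟨s, hs, u, a, b, hu, h, rfl⟩
  exact ⟨s, hs, u, a, b, hu, _root_.trans h hw, rfl⟩

theorem IsTrivialMod.mul (hlt : IsMonomialOrder lt) {w : FreeMonoid X}
    {f : FreeAlgebra K X} (hf : IsTrivialMod lt S w f) (a b : FreeMonoid X) :
    IsTrivialMod lt S (a * w * b) (word K a * f * word K b) := by
  induction hf using Submodule.span_induction with
  | mem x hx =>
    obtain ⟨s, hs, u, a', b', hu, h, rfl⟩ := hx
    convert isTrivialMod_of_lt hs hu (a := a * a') (b := b' * b) (w := a * w * b) ?_ using 1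
    · simp only [word_mul, mul_assoc]
    · simpa only [mul_assoc] using hlt.2 _ _ a b h
  | zero => simpa using isTrivialMod_zero _
  | add x y _ _ hx hy =>
    rw [mul_add, add_mul]
    exact hx.add hy
  | smul c x _ hx =>
    rw [mul_smul_comm, smul_mul_assoc]
    exact hx.smul c

theorem IsTrivialMod.mem_lower (hlt : IsMonomialOrder lt) (hS : ∀ s ∈ S, IsMonic lt s)
    {w : FreeMonoid X} {f : FreeAlgebra K X} (hf : IsTrivialMod lt S w f) : f ∈ lower K lt w := by
  refine Submodule.span_le.2 ?_ hf
  rintro _ ⟨s, hs, u, a, b, hu, h, rfl⟩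
  have h1 := lower_mono hlt h (mul_mem_lower hlt ((hS s hs).sub_mem_lower hlt hu) a b)
  have h2 := add_mem h1 (word_mem_lower (K := K) h)
  simpa only [mul_sub, sub_mul, word_mul, sub_add_cancel, SetLike.mem_coe] using h2

/-- Each word `v'` of `f` is smaller than `v`, so the term `s c v'` has leading word `u c v'`, below
`u c v`. -/
theorem isTrivialMod_mul_of_mem_lower_right (hlt : IsMonomialOrder lt) {s f : FreeAlgebra K X}
    (hs : s ∈ S) {u c v : FreeMonoid X} (hu : IsLeadingWord lt s u) (hf : f ∈ lower K lt v) :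
    IsTrivialMod lt S (u * c * v) (s * word K c * f) := by
  induction hf using Submodule.span_induction with
  | mem x hx =>
    obtain ⟨v', hv', rfl⟩ := hx
    convert isTrivialMod_of_lt hs hu (a := 1) (b := c * v') (w := u * c * v) ?_ using 1
    · simp only [word_one, one_mul, word_mul, mul_assoc]
    · simpa only [one_mul, mul_one, mul_assoc] using hlt.2 _ _ (u * c) 1 hv'
  | zero => simpa using isTrivialMod_zero _
  | add x y _ _ hx hy =>
    rw [mul_add]
    exact hx.add hy
  | smul a x _ hx =>
    rw [mul_smul_comm]
    exact hx.smul a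

theorem isTrivialMod_mul_of_mem_lower_left (hlt : IsMonomialOrder lt) {s f : FreeAlgebra K X}
    (hs : s ∈ S) {u c v : FreeMonoid X} (hu : IsLeadingWord lt s u) (hf : f ∈ lower K lt v) :
    IsTrivialMod lt S (v * c * u) (f * word K c * s) := by
  induction hf using Submodule.span_induction with
  | mem x hx =>
    obtain ⟨v', hv', rfl⟩ := hx
    convert isTrivialMod_of_lt hs hu (a := v' * c) (b := 1) (w := v * c * u) ?_ using 1
    · simp only [word_one, mul_one, word_mul]
    · simpa only [one_mul, mul_one, mul_assoc] using hlt.2 _ _ 1 (c * u) hv'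
  | zero => simpa using isTrivialMod_zero _
  | add x y _ _ hx hy =>
    rw [add_mul, add_mul]
    exact hx.add hy
  | smul a x _ hx =>
    rw [smul_mul_assoc, smul_mul_assoc]
    exact hx.smul a

/-! ### Two occurrences of leading words in one word -/

theorem isTrivialMod_disjoint (hlt : IsMonomialOrder lt) (hS : ∀ s ∈ S, IsMonic lt s)
    {s t : FreeAlgebra K X} (hs : s ∈ S) (ht : t ∈ S) {u v : FreeMonoid X} (c : FreeMonoid X)
    (hu : IsLeadingWord lt s u) (hv : IsLeadingWord lt t v) :
    IsTrivialMod lt S (u * c * v) (s * word K (c * v) - word K (u * c) * t) := by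
  -- The identity is `s c v - u c t = (s - u) c t - s c (t - v)`, where `s - u` and `t - v` contain
  -- only words below `u` and `v`.
  convert (isTrivialMod_mul_of_mem_lower_left hlt ht (c := c) hv
    ((hS s hs).sub_mem_lower hlt hu)).sub (isTrivialMod_mul_of_mem_lower_right hlt hs (c := c) hu
    ((hS t ht).sub_mem_lower hlt hv)) using 1
  simp only [word_mul]
  noncomm_ring

theorem isTrivialMod_of_inclusion {f g : FreeAlgebra K X}
    (htriv : ∀ w h, IsComposition lt f g w h → IsTrivialMod lt S w h)
    {a v b : FreeMonoid X} (hf : IsLeadingWord lt f (a * v * b)) (hg : IsLeadingWord lt g v) :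
    IsTrivialMod lt S (a * v * b) (f - word K a * g * word K b) :=
  htriv _ _ (.inclusion a b ⟨v, hf, hg, rfl⟩)

/-- The elements `s b` and `c t` with a common leading word `w` agree modulo `(S, w)`. -/
theorem isTrivialMod_mul_sub_mul (hlt : IsMonomialOrder lt) (hS : ∀ s ∈ S, IsMonic lt s)
    (htriv : ∀ f ∈ S, ∀ g ∈ S, ∀ w h, IsComposition lt f g w h → IsTrivialMod lt S w h)
    {s t : FreeAlgebra K X} (hs : s ∈ S) (ht : t ∈ S) {u v b c d : FreeMonoid X}
    (hu : IsLeadingWord lt s u) (hv : IsLeadingWord lt t v) (h : u * b = c * v * d) :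
    IsTrivialMod lt S (u * b) (s * word K b - word K c * t * word K d) := by
  have h' : u.toList ++ b.toList = c.toList ++ (v.toList ++ d.toList) := by
    simpa [mul_assoc] using congrArg FreeMonoid.toList h
  -- Three positions of `v`: it starts after `u` ends, it lies inside `u`, or it starts inside `u`
  -- and reaches at least to its end.
  rcases List.append_eq_append_iff.1 h' with ⟨e, he1, he2⟩ | ⟨e, he1, he2⟩
  · obtain ⟨e, rfl⟩ := FreeMonoid.toList.surjective e
    obtain rfl : c = u * e := FreeMonoid.toList.injective he1
    obtain rfl : b = e * v * d := FreeMonoid.toList.injective (by simpa using he2)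
    have := (isTrivialMod_disjoint hlt hS hs ht e hu hv).mul hlt 1 d
    simpa only [word_one, one_mul, mul_sub, sub_mul, word_mul, mul_assoc] using this
  · obtain ⟨e, rfl⟩ := FreeMonoid.toList.surjective e
    obtain rfl : u = c * e := FreeMonoid.toList.injective he1
    rcases List.append_eq_append_iff.1 he2 with ⟨e', he1', he2'⟩ | ⟨e', he1', he2'⟩
    · obtain ⟨e', rfl⟩ := FreeMonoid.toList.surjective e'
      obtain rfl : e = v * e' := FreeMonoid.toList.injective he1'
      obtain rfl : d = e' * b := FreeMonoid.toList.injective (by simpa using he2')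
      rw [← mul_assoc] at hu ⊢
      have := (isTrivialMod_of_inclusion (htriv s hs t ht) hu hv).mul hlt 1 b
      simpa only [word_one, one_mul, mul_sub, sub_mul, word_mul, mul_assoc] using this
    · obtain ⟨e', rfl⟩ := FreeMonoid.toList.surjective e'
      obtain rfl : v = e * e' := FreeMonoid.toList.injective he1'
      obtain rfl : b = e' * d := FreeMonoid.toList.injective (by simpa using he2')
      clear he1 he1' he2 he2' h h'
      -- Here `u = c e` and `v = e e'`. An intersection needs all three pieces nonempty; the
      -- degenerate cases are `u` a prefix of `v`, `v` a suffix of `u`, and adjacent factors.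
      have key : IsTrivialMod lt S (c * e * e') (s * word K e' - word K c * t) := by
        by_cases hc : c = 1
        · subst hc
          rw [one_mul] at hu ⊢
          simpa using (isTrivialMod_of_inclusion (htriv t ht s hs) (a := 1) (b := e')
            (by simpa using hv) hu).neg
        by_cases he' : e' = 1
        · subst he'
          rw [mul_one] at hv ⊢
          simpa using isTrivialMod_of_inclusion (htriv s hs t ht) (a := c) (b := 1)
            (by simpa using hu) hv
        by_cases he : e = 1
        · subst he
          simpa using isTrivialMod_disjoint hlt hS hs ht 1 hu hv
        refine htriv s hs t ht _ _ (.intersection c e' ⟨_, _, hu, hv, rfl, mul_assoc _ _ _, hc,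
          he', ?_⟩)
        have : e.length ≠ 0 := fun h0 => he (FreeMonoid.length_eq_zero.1 h0)
        simp only [FreeMonoid.length_mul]
        omega
      have := key.mul hlt 1 d
      simpa only [word_one, one_mul, mul_sub, sub_mul, word_mul, mul_assoc] using this

/-- The prefix before the occurrence that starts first can be split off, which leaves the case where
one occurrence starts the word. -/
theorem isTrivialMod_sub_of_eq (hlt : IsMonomialOrder lt) (hS : ∀ s ∈ S, IsMonic lt s)
    (htriv : ∀ f ∈ S, ∀ g ∈ S, ∀ w h, IsComposition lt f g w h → IsTrivialMod lt S w h)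
    {s t : FreeAlgebra K X} (hs : s ∈ S) (ht : t ∈ S) {u v a b c d : FreeMonoid X}
    (hu : IsLeadingWord lt s u) (hv : IsLeadingWord lt t v) (h : a * u * b = c * v * d) :
    IsTrivialMod lt S (a * u * b) (word K a * s * word K b - word K c * t * word K d) := by
  have h' : a.toList ++ (u.toList ++ b.toList) = c.toList ++ (v.toList ++ d.toList) := by
    simpa [mul_assoc] using congrArg FreeMonoid.toList h
  rcases List.append_eq_append_iff.1 h' with ⟨e, he1, he2⟩ | ⟨e, he1, he2⟩
  · obtain ⟨e, rfl⟩ := FreeMonoid.toList.surjective e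
    obtain rfl : c = a * e := FreeMonoid.toList.injective he1
    have := (isTrivialMod_mul_sub_mul hlt hS htriv hs ht (b := b) (c := e) (d := d) hu hv
      (FreeMonoid.toList.injective (by simpa using he2))).mul hlt a 1
    simpa only [word_one, mul_one, mul_sub, word_mul, mul_assoc] using this
  · obtain ⟨e, rfl⟩ := FreeMonoid.toList.surjective e
    obtain rfl : a = c * e := FreeMonoid.toList.injective he1
    have he : v * d = e * u * b := FreeMonoid.toList.injective (by simpa using he2)
    have := ((isTrivialMod_mul_sub_mul hlt hS htriv ht hs hv hu he).mul hlt c 1).neg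
    rw [h]
    simpa only [word_one, mul_one, mul_sub, word_mul, mul_assoc, neg_sub] using this

/-! ### The Composition-Diamond lemma -/

/-- If all compositions are trivial, a nonzero element of `⟨S⟩` has a representation with a
single term of the maximal leading word. -/
theorem IsTrivialMod.eq_zero_or_exists (hlt : IsMonomialOrder lt) (hS : ∀ s ∈ S, IsMonic lt s)
    (htriv : ∀ f ∈ S, ∀ g ∈ S, ∀ w h, IsComposition lt f g w h → IsTrivialMod lt S w h)
    (w : FreeMonoid X) (f : FreeAlgebra K X) (hf : IsTrivialMod lt S w f) :
    f = 0 ∨ ∃ s ∈ S, ∃ v a b, IsLeadingWord lt s v ∧ lt (a * v * b) w ∧ ∃ c : K, c ≠ 0 ∧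
      IsTrivialMod lt S (a * v * b) (f - c • (word K a * s * word K b)) := by
  have := hlt.1
  -- The outer induction on the bound `w` is needed only when two top terms cancel. The inner one
  -- builds the representation term by term.
  induction w using (IsWellFounded.wf : WellFounded lt).induction generalizing f with
  | _ w ih =>
  induction hf using Submodule.span_induction with
  | mem x hx =>
    obtain ⟨s, hs, u, a, b, hu, h, rfl⟩ := hx
    exact .inr ⟨s, hs, u, a, b, hu, h, 1, one_ne_zero, by simpa using isTrivialMod_zero _⟩
  | zero => exact .inl rfl
  | add x y _ _ hx hy =>
    rcases hx with rfl | ⟨s, hs, u, a, b, hu, hlt₁, c, hc, h₁⟩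
    · simpa using hy
    rcases hy with rfl | ⟨s', hs', u', a', b', hu', hlt₂, c', hc', h₂⟩
    · exact .inr ⟨s, hs, u, a, b, hu, hlt₁, c, hc, by simpa using h₁⟩
    rcases trichotomous_of lt (a * u * b) (a' * u' * b') with hl | he | hl
    · refine .inr ⟨s', hs', u', a', b', hu', hlt₂, c', hc', ?_⟩
      convert ((h₁.mono hlt hl).add ((isTrivialMod_of_lt hs hu hl).smul c)).add h₂ using 1
      abel
    · have hd := isTrivialMod_sub_of_eq hlt hS htriv hs hs' hu hu' he
      have hsum : IsTrivialMod lt S (a * u * b)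
          (x + y - (c + c') • (word K a * s * word K b)) := by
        convert (h₁.add (he ▸ h₂)).sub (hd.smul c') using 1
        module
      -- On cancellation the sum is trivial modulo `a u b`, which is below `w`, so the outer
      -- induction applies.
      by_cases hcc : c + c' = 0
      · rw [hcc, zero_smul, sub_zero] at hsum
        rcases ih _ hlt₁ _ hsum with h0 | ⟨t, ht, v, d, e, hv, hl, h⟩
        · exact .inl h0
        · exact .inr ⟨t, ht, v, d, e, hv, _root_.trans hl hlt₁, h⟩
      · exact .inr ⟨s, hs, u, a, b, hu, hlt₁, _, hcc, hsum⟩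
    · refine .inr ⟨s, hs, u, a, b, hu, hlt₁, c, hc, ?_⟩
      convert ((h₂.mono hlt hl).add ((isTrivialMod_of_lt hs' hu' hl).smul c')).add h₁ using 1
      abel
  | smul k x _ hx =>
    rcases hx with rfl | ⟨s, hs, u, a, b, hu, hl, c, hc, h⟩
    · exact .inl (smul_zero _)
    by_cases hk : k = 0
    · exact .inl (by rw [hk, zero_smul])
    refine .inr ⟨s, hs, u, a, b, hu, hl, k * c, mul_ne_zero hk hc, ?_⟩
    simpa only [smul_sub, mul_smul] using h.smul k

/-- Triviality bounds leading words strictly, so a bound above a given word must exist. Appending a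
letter provides it, because every letter exceeds the empty word. -/
theorem exists_lt_word [Nonempty X] (hlt : IsMonomialOrder lt) (w : FreeMonoid X) :
    ∃ w', lt w w' := by
  have := hlt.1
  obtain ⟨x⟩ := ‹Nonempty X›
  refine ⟨w * FreeMonoid.of x, ?_⟩
  rcases trichotomous_of lt 1 (FreeMonoid.of x) with h | h | h
  · simpa using hlt.2 _ _ w 1 h
  · exact absurd h.symm (FreeMonoid.of_ne_one x)
  -- If a letter `x` were below `1`, then `m x` would be below the least word `m`.
  · have hwf : WellFounded lt := IsWellFounded.wf
    refine absurd ?_ (hwf.not_lt_min Set.univ (x := hwf.min Set.univ ⟨w, trivial⟩ * FreeMonoid.of x)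
      trivial)
    simpa using hlt.2 _ _ (hwf.min Set.univ ⟨w, trivial⟩) 1 h

theorem mem_top_mul_span_mul_top {f : FreeAlgebra K X} (hf : f ∈ TwoSidedIdeal.span S) :
    f ∈ (⊤ * Submodule.span K S * ⊤ : Submodule K (FreeAlgebra K X)) := by
  have htop : (⊤ * ⊤ : Submodule K (FreeAlgebra K X)) = ⊤ :=
    eq_top_iff.2 fun x _ => by
      simpa using Submodule.mul_mem_mul (Submodule.mem_top (R := K) (x := x))
        (Submodule.mem_top (R := K) (x := (1 : FreeAlgebra K X)))
  induction hf using TwoSidedIdeal.span_induction with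
  | mem x hx =>
    simpa using Submodule.mul_mem_mul (Submodule.mul_mem_mul (Submodule.mem_top (R := K)
      (x := (1 : FreeAlgebra K X))) (Submodule.subset_span (R := K) hx))
      (Submodule.mem_top (R := K) (x := (1 : FreeAlgebra K X)))
  | zero => exact zero_mem _
  | add x y _ _ hx hy => exact add_mem hx hy
  | neg x _ hx => exact neg_mem hx
  | left_absorb r x _ hx =>
    have := Submodule.mul_mem_mul (Submodule.mem_top (R := K) (x := r)) hx
    rwa [← mul_assoc, ← mul_assoc, htop] at this
  | right_absorb r x _ hx =>
    have := Submodule.mul_mem_mul hx (Submodule.mem_top (R := K) (x := r))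
    rwa [mul_assoc, htop] at this

/-- Since words span the algebra, an element of the ideal is a finite combination of terms `a s b`;
any word above all their leading words is a bound. -/
theorem exists_isTrivialMod [Nonempty X] (hlt : IsMonomialOrder lt)
    (hS : ∀ s ∈ S, IsMonic lt s) {f : FreeAlgebra K X} (hf : f ∈ TwoSidedIdeal.span S) :
    ∃ w, IsTrivialMod lt S w f := by
  have := hlt.1
  have hf' := mem_top_mul_span_mul_top hf
  rw [← span_range_word, Submodule.span_mul_span, Submodule.span_mul_span] at hf'
  clear hf
  induction hf' using Submodule.span_induction with
  | mem x hx =>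
    obtain ⟨_, ⟨_, ⟨a, rfl⟩, s, hs, rfl⟩, _, ⟨b, rfl⟩, rfl⟩ := hx
    obtain ⟨u, hu, -⟩ := hS s hs
    obtain ⟨w, hw⟩ := exists_lt_word hlt (a * u * b)
    exact ⟨w, isTrivialMod_of_lt hs hu hw⟩
  | zero => exact ⟨1, isTrivialMod_zero _⟩
  | add x y _ _ hx hy =>
    obtain ⟨u, hu⟩ := hx
    obtain ⟨v, hv⟩ := hy
    rcases trichotomous_of lt u v with h | rfl | h
    · exact ⟨v, (hu.mono hlt h).add hv⟩
    · exact ⟨u, hu.add hv⟩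
    · exact ⟨u, hu.add (hv.mono hlt h)⟩
  | smul c x _ hx =>
    obtain ⟨u, hu⟩ := hx
    exact ⟨u, hu.smul c⟩

/-- The Composition-Diamond lemma: the leading word of a nonzero element of the ideal generated by
a Gröbner–Shirshov basis contains the leading word of an element of the basis. -/
theorem IsGroebnerShirshovBasis.exists_leadingWord_factor [Nonempty X]
    {J : TwoSidedIdeal (FreeAlgebra K X)} (hJ : IsGroebnerShirshovBasis lt S J)
    (hlt : IsMonomialOrder lt) {f : FreeAlgebra K X} (hf : f ∈ J) (hf0 : f ≠ 0) :
    ∃ s ∈ S, ∃ u v a b : FreeMonoid X,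
      IsLeadingWord lt f u ∧ IsLeadingWord lt s v ∧ u = a * v * b := by
  obtain ⟨w, hw⟩ := exists_isTrivialMod hlt hJ.monic (hJ.span_eq ▸ hf)
  rcases hw.eq_zero_or_exists hlt hJ.monic hJ.trivial with h0 | ⟨s, hs, v, a, b, hv, -, c, hc, h⟩
  · exact absurd h0 hf0
  -- The remainder and the tail of `c a s b` both lie below `a v b`, so `a v b` is the leading word
  -- of `f`.
  refine ⟨s, hs, _, v, a, b, (isLeadingWord_of_sub_mem_lower hlt hc ?_).1, hv, rfl⟩
  have h1 := mul_mem_lower hlt ((hJ.monic s hs).sub_mem_lower hlt hv) a b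
  convert add_mem (h.mem_lower hlt hJ.monic) (Submodule.smul_mem _ c h1) using 1
  simp only [word_mul, mul_sub, sub_mul, smul_sub]
  abel

end GroebnerShirshov

namespace QuantumMatrix

open GroebnerShirshov

variable {K : Type*} [Field K] {n : ℕ} {q : K}

/-! ### The degree right lexicographic ordering -/

instance : IsWellOrder (Fin n × Fin n) letterLt where
  wf := by
    have : IsTrans (Fin n × Fin n) letterLt := ⟨fun a b c h h' => by
      unfold letterLt at *; omega⟩
    have : Std.Irrefl (letterLt (n := n)) := ⟨fun a h => by unfold letterLt at h; omega⟩
    exact Finite.wellFounded_of_trans_of_irrefl _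
  trichotomous a b h h' := by
    unfold letterLt at *
    exact Prod.ext (by omega) (by omega)

theorem degRlex_iff_shortlex {u v : FreeMonoid (Fin n × Fin n)} :
    degRlex u v ↔ List.Shortlex letterLt u.toList.reverse v.toList.reverse := by
  simp [degRlex, List.shortlex_def, FreeMonoid.length]

/-- Equal lengths matter: a proper prefix is smaller than its extension, but appending `l` may
reverse this. -/
theorem lex_append_right {α : Type*} {r : α → α → Prop} {s t : List α} (h : List.Lex r s t)
    (hl : s.length = t.length) (l : List α) : List.Lex r (s ++ l) (t ++ l) := by
  induction h with
  | nil => simp at hl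
  | rel h => exact .rel h
  | cons _ ih => exact .cons (ih (by simpa using hl))

theorem isMonomialOrder_degRlex : IsMonomialOrder (degRlex (n := n)) := by
  refine ⟨{ wf := ?_, trichotomous := fun u v h h' => ?_ }, fun u v w r h => ?_⟩
  · refine Subrelation.wf (fun h => degRlex_iff_shortlex.1 h) (InvImage.wf
      (fun u : FreeMonoid (Fin n × Fin n) => u.toList.reverse)
      (List.Shortlex.wf (IsWellFounded.wf (r := letterLt (n := n)))))
  · rw [degRlex_iff_shortlex] at h h'
    exact FreeMonoid.toList.injective (List.reverse_injective
      ((inferInstance : Std.Trichotomous (List.Shortlex (letterLt (n := n)))).trichotomous _ _ h h'))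
  · rcases h with h | ⟨h, hlex⟩
    · left
      simpa only [FreeMonoid.length_mul, add_lt_add_iff_right, add_lt_add_iff_left] using h
    · right
      refine ⟨by simp only [FreeMonoid.length_mul, h], ?_⟩
      simp only [FreeMonoid.toList_mul, List.reverse_append]
      -- Reversal turns the left factor `w` into a common suffix and the right factor `r` into a
      -- common prefix.
      exact (lex_append_right hlex
        (by rw [List.length_reverse, List.length_reverse]; exact h) _).append_left _ _

theorem lex_cons_cons_iff {α : Type*} {r : α → α → Prop} {a b : α} {s t : List α} :
    List.Lex r (a :: s) (b :: t) ↔ r a b ∨ a = b ∧ List.Lex r s t := by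
  constructor
  · rintro (_ | h | h)
    · exact .inl h
    · exact .inr ⟨rfl, h⟩
  · rintro (h | ⟨rfl, h⟩)
    · exact .rel h
    · exact .cons h

theorem degRlex_two {x y x' y' : Fin n × Fin n} :
    degRlex (FreeMonoid.of x * FreeMonoid.of y) (FreeMonoid.of x' * FreeMonoid.of y') ↔
      letterLt y y' ∨ y = y' ∧ letterLt x x' := by
  simp [degRlex, lex_cons_cons_iff]

/-- The order on triples `Z_ab Z_cd Z_ef` of generators. -/
def TripleLt {n : ℕ} (a b c d e f a' b' c' d' e' f' : Fin n) : Prop :=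
  e < e' ∨ e = e' ∧ (f < f' ∨ f = f' ∧ (c < c' ∨ c = c' ∧ (d < d' ∨ d = d' ∧
    (a < a' ∨ a = a' ∧ b < b'))))

/-- Reduces comparison of words of length three to inequalities between indices, which `omega`
decides. -/
theorem degRlex_word3 {a b c d e f a' b' c' d' e' f' : Fin n} :
    degRlex (word3 a b c d e f) (word3 a' b' c' d' e' f') ↔
      TripleLt a b c d e f a' b' c' d' e' f' := by
  simp [degRlex, word3, lex_cons_cons_iff, TripleLt, letterLt]
  tauto

/-! ### Leading words of the defining relations -/

theorem word_of (x : Fin n × Fin n) : word K (FreeMonoid.of x) = Z K x.1 x.2 :=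
  FreeMonoid.lift_eval_of _ _

theorem Z_mul_Z (i j s t : Fin n) :
    Z K i j * Z K s t = word K (FreeMonoid.of (i, j) * FreeMonoid.of (s, t)) := by
  simp only [word_mul, word_of]

/-- `f` has the leading term `x y`. -/
def LeadsWith (f : FreeAlgebra K (Fin n × Fin n)) (x y : Fin n × Fin n) : Prop :=
  f - word K (FreeMonoid.of x * FreeMonoid.of y) ∈
    lower K degRlex (FreeMonoid.of x * FreeMonoid.of y)

theorem LeadsWith.isLeadingWord {f : FreeAlgebra K (Fin n × Fin n)} {x y : Fin n × Fin n}
    (h : LeadsWith f x y) : IsLeadingWord degRlex f (FreeMonoid.of x * FreeMonoid.of y) ∧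
      coeff f (FreeMonoid.of x * FreeMonoid.of y) = 1 :=
  isLeadingWord_of_sub_mem_lower isMonomialOrder_degRlex one_ne_zero (by rwa [one_smul])

theorem leadsWith_a (q : K) {i j k : Fin n} (h : j < k) :
    LeadsWith (Z K i j * Z K i k - q • (Z K i k * Z K i j)) (i, j) (i, k) := by
  rw [LeadsWith, Z_mul_Z, Z_mul_Z, sub_sub_cancel_left]
  exact neg_mem (Submodule.smul_mem _ _ (word_mem_lower (degRlex_two.2 (by simp [letterLt, h]))))

theorem leadsWith_b (q : K) {i j k : Fin n} (h : i < k) :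
    LeadsWith (Z K i j * Z K k j - q • (Z K k j * Z K i j)) (i, j) (k, j) := by
  rw [LeadsWith, Z_mul_Z, Z_mul_Z, sub_sub_cancel_left]
  exact neg_mem (Submodule.smul_mem _ _ (word_mem_lower (degRlex_two.2 (by simp [letterLt, h]))))

theorem leadsWith_c {i j s t : Fin n} (h : i < s) :
    LeadsWith (Z K i j * Z K s t - Z K s t * Z K i j) (i, j) (s, t) := by
  rw [LeadsWith, Z_mul_Z, Z_mul_Z, sub_sub_cancel_left]
  exact neg_mem (word_mem_lower (degRlex_two.2 (by simp [letterLt, h])))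

/-- Both tail words end in a letter below `Z_st`: in `Z_ij` because `i < s`, and in `Z_sj` because
`j < t`. -/
theorem leadsWith_d (q : K) {i j s t : Fin n} (h : i < s) (h' : j < t) :
    LeadsWith (Z K i j * Z K s t - Z K s t * Z K i j - (q - q⁻¹) • (Z K i t * Z K s j))
      (i, j) (s, t) := by
  rw [LeadsWith, Z_mul_Z, Z_mul_Z, Z_mul_Z, sub_right_comm, sub_sub_cancel_left]
  exact sub_mem (neg_mem (word_mem_lower (degRlex_two.2 (by simp [letterLt, h]))))
    (Submodule.smul_mem _ _ (word_mem_lower (degRlex_two.2 (by simp [letterLt, h']))))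

theorem Rel.exists_leadsWith {f : FreeAlgebra K (Fin n × Fin n)} (hf : Rel K n q f) :
    ∃ x y, letterLt x y ∧ LeadsWith f x y := by
  cases hf with
  | a i j k h => exact ⟨_, _, by simp [letterLt, h], leadsWith_a q h⟩
  | b i j k h => exact ⟨_, _, by simp [letterLt, h], leadsWith_b q h⟩
  | c i j s t h₁ h₂ => exact ⟨_, _, by simp [letterLt, h₁], leadsWith_c h₁⟩
  | d i j s t h₁ h₂ => exact ⟨_, _, by simp [letterLt, h₁], leadsWith_d q h₁ h₂⟩

theorem exists_rel_leadsWith (q : K) {x y : Fin n × Fin n} (h : letterLt x y) :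
    ∃ f, Rel K n q f ∧ LeadsWith f x y := by
  obtain ⟨i, j⟩ := x
  obtain ⟨s, t⟩ := y
  rcases h with h | ⟨rfl : i = s, h⟩
  · rcases lt_trichotomy j t with h' | rfl | h'
    · exact ⟨_, .d i j s t h h', leadsWith_d q h h'⟩
    · exact ⟨_, .b i j s h, leadsWith_b q h⟩
    · exact ⟨_, .c i j s t h h', leadsWith_c h⟩
  · exact ⟨_, .a i j t h, leadsWith_a q h⟩

theorem LeadsWith.eq {f : FreeAlgebra K (Fin n × Fin n)} {x y x' y' : Fin n × Fin n}
    (h : LeadsWith f x y) (h' : LeadsWith f x' y') : x = x' ∧ y = y' := by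
  have := congrArg FreeMonoid.toList
    (h.isLeadingWord.1.unique isMonomialOrder_degRlex h'.isLeadingWord.1)
  simpa using this

/-- The shape of a defining relation with the leading term `Z_ij Z_st`. -/
theorem Rel.cases_of_leadsWith {f : FreeAlgebra K (Fin n × Fin n)} (hf : Rel K n q f)
    {i j s t : Fin n} (h : LeadsWith f (i, j) (s, t)) :
    (i = s ∧ j < t ∧ f = Z K i j * Z K i t - q • (Z K i t * Z K i j)) ∨
    (i < s ∧ j = t ∧ f = Z K i j * Z K s j - q • (Z K s j * Z K i j)) ∨
    (i < s ∧ t < j ∧ f = Z K i j * Z K s t - Z K s t * Z K i j) ∨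
    (i < s ∧ j < t ∧ f = Z K i j * Z K s t - Z K s t * Z K i j -
      (q - q⁻¹) • (Z K i t * Z K s j)) := by
  cases hf with
  | a i j k h₁ =>
    have := h.eq (leadsWith_a q h₁)
    simp only [Prod.mk.injEq] at this
    obtain ⟨⟨rfl, rfl⟩, rfl, rfl⟩ := this
    exact .inl ⟨rfl, h₁, rfl⟩
  | b i j k h₁ =>
    have := h.eq (leadsWith_b q h₁)
    simp only [Prod.mk.injEq] at this
    obtain ⟨⟨rfl, rfl⟩, rfl, rfl⟩ := this
    exact .inr (.inl ⟨h₁, rfl, rfl⟩)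
  | c i j s t h₁ h₂ =>
    have := h.eq (leadsWith_c h₁)
    simp only [Prod.mk.injEq] at this
    obtain ⟨⟨rfl, rfl⟩, rfl, rfl⟩ := this
    exact .inr (.inr (.inl ⟨h₁, h₂, rfl⟩))
  | d i j s t h₁ h₂ =>
    have := h.eq (leadsWith_d q h₁ h₂)
    simp only [Prod.mk.injEq] at this
    obtain ⟨⟨rfl, rfl⟩, rfl, rfl⟩ := this
    exact .inr (.inr (.inr ⟨h₁, h₂, rfl⟩))

/-- The index conditions of the four types exclude each other. This leaves only the inclusions of a
relation in itself. -/
theorem Rel.eq_of_leadsWith {f g : FreeAlgebra K (Fin n × Fin n)} (hf : Rel K n q f)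
    (hg : Rel K n q g) {x y : Fin n × Fin n} (h : LeadsWith f x y) (h' : LeadsWith g x y) :
    f = g := by
  obtain ⟨i, j⟩ := x
  obtain ⟨s, t⟩ := y
  rcases hf.cases_of_leadsWith h with
    ⟨h₁, h₂, rfl⟩ | ⟨h₁, h₂, rfl⟩ | ⟨h₁, h₂, rfl⟩ | ⟨h₁, h₂, rfl⟩ <;>
  rcases hg.cases_of_leadsWith h' with
    ⟨h₃, h₄, rfl⟩ | ⟨h₃, h₄, rfl⟩ | ⟨h₃, h₄, rfl⟩ | ⟨h₃, h₄, rfl⟩ <;>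
  first | rfl | (exfalso; omega)

/-! ### The sixteen families of overlaps -/

/-- An overlap of the leading words of two defining relations consists of three letters. -/
theorem LeadsWith.of_isIntersection {f g : FreeAlgebra K (Fin n × Fin n)}
    {x y x' y' : Fin n × Fin n} (hf : LeadsWith f x y) (hg : LeadsWith g x' y')
    {a b w : FreeMonoid (Fin n × Fin n)} (h : IsIntersection degRlex f g a b w) :
    y = x' ∧ a = FreeMonoid.of x ∧ b = FreeMonoid.of y' ∧
      w = FreeMonoid.of x * FreeMonoid.of y * FreeMonoid.of y' := by
  obtain ⟨u, v, hu, hv, rfl, hw, ha, hb, hl⟩ := h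
  obtain rfl := hu.unique isMonomialOrder_degRlex hf.isLeadingWord.1
  obtain rfl := hv.unique isMonomialOrder_degRlex hg.isLeadingWord.1
  have hb1 : b.length = 1 := by
    have : b.length ≠ 0 := fun h0 => hb (FreeMonoid.length_eq_zero.1 h0)
    simp only [FreeMonoid.length_mul, FreeMonoid.length_of] at hl
    omega
  have ha1 : a.length = 1 := by
    have := congrArg FreeMonoid.length hw
    simp only [FreeMonoid.length_mul, FreeMonoid.length_of] at this
    omega
  obtain ⟨a, rfl⟩ := FreeMonoid.length_eq_one.1 ha1
  obtain ⟨b, rfl⟩ := FreeMonoid.length_eq_one.1 hb1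
  have := congrArg FreeMonoid.toList hw
  simp at this
  obtain ⟨rfl, rfl, rfl⟩ := this
  exact ⟨rfl, rfl, rfl, rfl⟩

theorem exists_isIntersection_iff (q : K) (w : FreeMonoid (Fin n × Fin n)) :
    (∃ f ∈ relations K n q, ∃ g ∈ relations K n q, ∃ a b, IsIntersection degRlex f g a b w) ↔
      Ambiguity w := by
  constructor
  · rintro ⟨f, hf : Rel K n q f, g, hg : Rel K n q g, a, b, h⟩
    obtain ⟨⟨i, j⟩, ⟨s, t⟩, -, hfl⟩ := hf.exists_leadsWith
    obtain ⟨⟨s', t'⟩, ⟨k, l⟩, -, hgl⟩ := hg.exists_leadsWith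
    obtain ⟨he, -, -, rfl⟩ := hfl.of_isIntersection hgl h
    obtain ⟨rfl, rfl⟩ := Prod.mk.inj he
    rcases hf.cases_of_leadsWith hfl with
      ⟨rfl, h₂, -⟩ | ⟨h₁, rfl, -⟩ | ⟨h₁, h₂, -⟩ | ⟨h₁, h₂, -⟩ <;>
    rcases hg.cases_of_leadsWith hgl with ⟨rfl, h₄, -⟩ | ⟨h₃, rfl, -⟩ | ⟨h₃, h₄, -⟩ | ⟨h₃, h₄, -⟩
    · exact .aa _ _ _ _ h₂ h₄
    · exact .ab₁ _ _ _ _ h₂ h₃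
    · exact .ac₂ _ _ _ _ _ h₂ h₃ h₄
    · exact .ad₂ _ _ _ _ _ h₃ h₂ h₄
    · exact .ab₂ _ _ _ _ h₁ h₄
    · exact .bb _ _ _ _ h₁ h₃
    · exact .bc₁ _ _ _ _ _ h₁ h₃ h₄
    · exact .bd₁ _ _ _ _ _ h₁ h₃ h₄
    · exact .ac₁ _ _ _ _ _ h₁ h₂ h₄
    · exact .bc₂ _ _ _ _ _ h₁ h₃ h₂
    · exact .cc _ _ _ _ _ _ h₁ h₃ h₄ h₂
    · exact .cd₁ _ _ _ _ _ _ h₁ h₃ h₂ h₄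
    · exact .ad₁ _ _ _ _ _ h₁ h₂ h₄
    · exact .bd₂ _ _ _ _ _ h₁ h₃ h₂
    · exact .cd₂ _ _ _ _ _ _ h₁ h₃ h₄ h₂
    · exact .dd _ _ _ _ _ _ h₁ h₃ h₂ h₄
  · intro h
    -- Each family consists of increasing triples, and each increasing pair is the leading word of
    -- some relation.
    have key : ∃ x y z, letterLt x y ∧ letterLt y z ∧
        w = FreeMonoid.of x * FreeMonoid.of y * FreeMonoid.of z := by
      cases h <;> exact ⟨_, _, _, by simp [letterLt, *], by simp [letterLt, *], rfl⟩
    obtain ⟨x, y, z, hxy, hyz, rfl⟩ := key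
    obtain ⟨f, hf, hfl⟩ := exists_rel_leadsWith q hxy
    obtain ⟨g, hg, hgl⟩ := exists_rel_leadsWith q hyz
    exact ⟨f, hf, g, hg, _, _, _, _, hfl.isLeadingWord.1, hgl.isLeadingWord.1, rfl,
      mul_assoc _ _ _, FreeMonoid.of_ne_one _, FreeMonoid.of_ne_one _,
      by simp [FreeMonoid.length_mul]⟩

/-! ### Confluence of the overlaps -/

/-- The defining relations as rewriting rules for triples of generators, valid for the triples
that satisfy `P`. The rules for the relations (c) carry a factor `1`, so that `simp`
does not take them for permutations. -/
structure RewriteRules {M : Type*} [AddCommGroup M] [Module K M] (q : K)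
    (m : Fin n → Fin n → Fin n → Fin n → Fin n → Fin n → M)
    (P : Fin n → Fin n → Fin n → Fin n → Fin n → Fin n → Prop) : Prop where
  a_left (i j k e f) : j < k → P i j i k e f → m i j i k e f = q • m i k i j e f
  b_left (i j k e f) : i < k → P i j k j e f → m i j k j e f = q • m k j i j e f
  c_left (i j s t e f) : i < s → t < j → P i j s t e f → m i j s t e f = (1 : K) • m s t i j e f
  d_left (i j s t e f) : i < s → j < t → P i j s t e f →
    m i j s t e f = m s t i j e f + (q - q⁻¹) • m i t s j e f
  a_right (i j k e f) : j < k → P e f i j i k → m e f i j i k = q • m e f i k i j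
  b_right (i j k e f) : i < k → P e f i j k j → m e f i j k j = q • m e f k j i j
  c_right (i j s t e f) : i < s → t < j → P e f i j s t → m e f i j s t = (1 : K) • m e f s t i j
  d_right (i j s t e f) : i < s → j < t → P e f i j s t →
    m e f i j s t = m e f s t i j + (q - q⁻¹) • m e f i t s j

theorem isTrivialMod_mul_Z {s : FreeAlgebra K (Fin n × Fin n)} (hs : Rel K n q s)
    {a b c d : Fin n} (h : LeadsWith s (a, b) (c, d)) {e f a' b' c' d' e' f' : Fin n}
    (hP : TripleLt a b c d e f a' b' c' d' e' f') :
    IsTrivialMod degRlex (relations K n q) (word3 a' b' c' d' e' f') (s * Z K e f) := by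
  simpa [word_of] using isTrivialMod_of_lt (S := relations K n q) hs (a := 1)
    (b := FreeMonoid.of (e, f)) h.isLeadingWord.1 (by rw [one_mul]; exact degRlex_word3.2 hP)

theorem isTrivialMod_Z_mul {s : FreeAlgebra K (Fin n × Fin n)} (hs : Rel K n q s)
    {c d e f : Fin n} (h : LeadsWith s (c, d) (e, f)) {a b a' b' c' d' e' f' : Fin n}
    (hP : TripleLt a b c d e f a' b' c' d' e' f') :
    IsTrivialMod degRlex (relations K n q) (word3 a' b' c' d' e' f') (Z K a b * s) := by
  simpa [word_of] using isTrivialMod_of_lt (S := relations K n q) hs (a := FreeMonoid.of (a, b))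
    (b := 1) h.isLeadingWord.1 (by rw [mul_one, ← mul_assoc]; exact degRlex_word3.2 hP)

/-- A relation times one generator, with leading word below `w`, is trivial modulo `w`. Thus `φ`
turns congruences into equations usable for rewriting, and the predicate `TripleLt` keeps every step
below `w`. -/
theorem rewriteRules_of_isTrivialMod {M : Type*} [AddCommGroup M] [Module K M] {i j s t k l : Fin n}
    (φ : FreeAlgebra K (Fin n × Fin n) →ₗ[K] M)
    (hφ : ∀ h, IsTrivialMod degRlex (relations K n q) (word3 i j s t k l) h → φ h = 0) :
    RewriteRules q (fun a b c d e f => φ (Z K a b * (Z K c d * Z K e f)))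
      (fun a b c d e f => TripleLt a b c d e f i j s t k l) where
  a_left _ _ _ _ _ h hP := by
    simpa only [sub_mul, smul_mul_assoc, mul_assoc, map_sub, map_smul, sub_eq_zero] using
      hφ _ (isTrivialMod_mul_Z (.a _ _ _ h) (leadsWith_a q h) hP)
  b_left _ _ _ _ _ h hP := by
    simpa only [sub_mul, smul_mul_assoc, mul_assoc, map_sub, map_smul, sub_eq_zero] using
      hφ _ (isTrivialMod_mul_Z (.b _ _ _ h) (leadsWith_b q h) hP)
  c_left _ _ _ _ _ _ h h' hP := by
    simpa only [sub_mul, mul_assoc, map_sub, one_smul, sub_eq_zero] using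
      hφ _ (isTrivialMod_mul_Z (.c _ _ _ _ h h') (leadsWith_c h) hP)
  d_left _ _ _ _ _ _ h h' hP := by
    simpa only [sub_mul, add_mul, smul_mul_assoc, mul_assoc, sub_sub, map_sub, map_add, map_smul,
      sub_eq_zero] using hφ _ (isTrivialMod_mul_Z (.d _ _ _ _ h h') (leadsWith_d q h h') hP)
  a_right _ _ _ _ _ h hP := by
    simpa only [mul_sub, mul_smul_comm, map_sub, map_smul, sub_eq_zero] using
      hφ _ (isTrivialMod_Z_mul (.a _ _ _ h) (leadsWith_a q h) hP)
  b_right _ _ _ _ _ h hP := by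
    simpa only [mul_sub, mul_smul_comm, map_sub, map_smul, sub_eq_zero] using
      hφ _ (isTrivialMod_Z_mul (.b _ _ _ h) (leadsWith_b q h) hP)
  c_right _ _ _ _ _ _ h h' hP := by
    simpa only [mul_sub, map_sub, one_smul, sub_eq_zero] using
      hφ _ (isTrivialMod_Z_mul (.c _ _ _ _ h h') (leadsWith_c h) hP)
  d_right _ _ _ _ _ _ h h' hP := by
    simpa only [mul_sub, mul_add, mul_smul_comm, sub_sub, map_sub, map_add, map_smul, sub_eq_zero] using
      hφ _ (isTrivialMod_Z_mul (.d _ _ _ _ h h') (leadsWith_d q h h') hP)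

set_option linter.unusedSimpArgs false in
set_option maxHeartbeats 4000000 in
/-- The overlaps of the defining relations are confluent: both sides are rewritten to the same
combination of descending words. -/
theorem overlap_eq_zero (hq : q ≠ 0) {f g : FreeAlgebra K (Fin n × Fin n)}
    (hf : Rel K n q f) (hg : Rel K n q g) {i j s t k l : Fin n}
    (hfl : LeadsWith f (i, j) (s, t)) (hgl : LeadsWith g (s, t) (k, l))
    {M : Type*} [AddCommGroup M] [Module K M] (φ : FreeAlgebra K (Fin n × Fin n) →ₗ[K] M)
    (hφ : ∀ h, IsTrivialMod degRlex (relations K n q) (word3 i j s t k l) h → φ h = 0) :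
    φ (f * Z K k l - Z K i j * g) = 0 := by
  -- Passing to an opaque function `m` of six indices makes each rule a plain equation between
  -- values of `m`.
  obtain ⟨m, hm, al, bl, cl, dl, ar, br, cr, dr⟩ :
      ∃ m : Fin n → Fin n → Fin n → Fin n → Fin n → Fin n → M,
        (∀ a b c d e f, φ (Z K a b * (Z K c d * Z K e f)) = m a b c d e f) ∧
        RewriteRules q m (fun a b c d e f => TripleLt a b c d e f i j s t k l) :=
    ⟨_, fun _ _ _ _ _ _ => rfl, rewriteRules_of_isTrivialMod φ hφ⟩
  clear hφ
  -- The types of `f` and `g` fix the order of the rows and compare `t` with `j` and `l`. The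
  -- comparison of `j` with `l` completes the order of the columns, so every later rewrite is
  -- determined.
  have hjl := lt_trichotomy j l
  rcases hf.cases_of_leadsWith hfl with
    ⟨rfl, h₂, rfl⟩ | ⟨h₁, rfl, rfl⟩ | ⟨h₁, h₂, rfl⟩ | ⟨h₁, h₂, rfl⟩ <;>
  rcases hg.cases_of_leadsWith hgl with
    ⟨rfl, h₄, rfl⟩ | ⟨h₃, rfl, rfl⟩ | ⟨h₃, h₄, rfl⟩ | ⟨h₃, h₄, rfl⟩ <;>
  clear hf hg hfl hgl <;>
  rcases hjl with hjl | hjl | hjl <;>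
  first
  | (exfalso; omega)
  | (try subst hjl
     simp only [sub_mul, mul_sub, smul_mul_assoc, mul_smul_comm, mul_assoc, map_sub, map_smul,
      hm]
     -- The triple `w` itself is not below `w`, so it is never rewritten; its two copies cancel in
     -- the comparison of coefficients.
     simp (disch := first | omega | (unfold TripleLt; omega)) only [al, bl, cl, dl, ar, br, cr, dr]
     match_scalars <;> field_simp <;> ring)

/-- Taking for `φ` the quotient map by the submodule of trivial elements, vanishing of the image is
triviality. -/
theorem isTrivialMod_overlap (hq : q ≠ 0) {f g : FreeAlgebra K (Fin n × Fin n)}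
    (hf : Rel K n q f) (hg : Rel K n q g) {i j s t k l : Fin n}
    (hfl : LeadsWith f (i, j) (s, t)) (hgl : LeadsWith g (s, t) (k, l)) :
    IsTrivialMod degRlex (relations K n q) (word3 i j s t k l) (f * Z K k l - Z K i j * g) :=
  (Submodule.Quotient.mk_eq_zero _).1 (overlap_eq_zero hq hf hg hfl hgl (Submodule.mkQ _)
    fun _ h => (Submodule.Quotient.mk_eq_zero _).2 h)

theorem isGroebnerShirshovBasis (hq : q ≠ 0) : IsGroebnerShirshovBasis degRlex (relations K n q)
    (TwoSidedIdeal.span (relations K n q)) where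
  monic s (hs : Rel K n q s) := by
    obtain ⟨x, y, -, h⟩ := hs.exists_leadsWith
    exact ⟨_, h.isLeadingWord⟩
  span_eq := rfl
  trivial f (hf : Rel K n q f) g (hg : Rel K n q g) w h hcomp := by
    obtain ⟨⟨i, j⟩, ⟨s, t⟩, -, hfl⟩ := hf.exists_leadsWith
    obtain ⟨⟨s', t'⟩, ⟨k, l⟩, -, hgl⟩ := hg.exists_leadsWith
    cases hcomp with
    | intersection a b h =>
      obtain ⟨he, rfl, rfl, rfl⟩ := hfl.of_isIntersection hgl h
      obtain ⟨rfl, rfl⟩ := Prod.mk.inj he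
      simpa only [word_of, word3] using isTrivialMod_overlap hq hf hg hfl hgl
    | inclusion a b h =>
      -- All leading words have length two, so `a = b = 1`, the two leading words agree, and the
      -- composition is `f - f`.
      obtain ⟨v, hw, hv, rfl⟩ := h
      obtain rfl := hv.unique isMonomialOrder_degRlex hgl.isLeadingWord.1
      have he := hw.unique isMonomialOrder_degRlex hfl.isLeadingWord.1
      have hl := congrArg FreeMonoid.length he
      simp only [FreeMonoid.length_mul, FreeMonoid.length_of] at hl
      obtain rfl : a = 1 := FreeMonoid.length_eq_zero.1 (by omega)
      obtain rfl : b = 1 := FreeMonoid.length_eq_zero.1 (by omega)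
      have he' := congrArg FreeMonoid.toList he
      simp at he'
      obtain ⟨⟨rfl, rfl⟩, rfl, rfl⟩ := he'
      obtain rfl := hf.eq_of_leadsWith hg hfl hgl
      simpa using isTrivialMod_zero _

end QuantumMatrix

open GroebnerShirshov QuantumMatrix in
theorem theorem2p1 (K : Type*) [Field K] [CharZero K] (n : ℕ) (hn : 2 ≤ n) (q : K) (hq : q ≠ 0)
    (J : TwoSidedIdeal (FreeAlgebra K (Fin n × Fin n)))
    (hJ : J = TwoSidedIdeal.span (relations K n q)) :
    IsMonomialOrder (degRlex (n := n)) ∧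
    IsGroebnerShirshovBasis degRlex (relations K n q) J ∧
    (∀ f ∈ J, f ≠ 0 → ∃ s ∈ relations K n q, ∃ u v a b : FreeMonoid (Fin n × Fin n),
      IsLeadingWord degRlex f u ∧ IsLeadingWord degRlex s v ∧ u = a * v * b) ∧
    (∀ w : FreeMonoid (Fin n × Fin n),
      (∃ f ∈ relations K n q, ∃ g ∈ relations K n q, ∃ a b, IsIntersection degRlex f g a b w) ↔
        Ambiguity w) := by
  subst hJ
  have : Nonempty (Fin n × Fin n) := ⟨(⟨0, by omega⟩, ⟨0, by omega⟩)⟩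
  exact ⟨isMonomialOrder_degRlex, isGroebnerShirshovBasis hq,
    fun f hf hf0 => (isGroebnerShirshovBasis hq).exists_leadingWord_factor
      isMonomialOrder_degRlex hf hf0, exists_isIntersection_iff q⟩
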